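/- Let $H$ be a complex Hilbert space and let $A\subseteq\mathbb B(H)$ be a C*-algebra, i.e. a norm-closed (not necessarily unital) *-subalgebra, acting non-degenerately on $H$ (the vectors $a\xi$, $a\in A$, $\xi\in H$, span a dense subspace). Put $$LM(A)=\{x\in\mathbb B(H): xA\subseteq A\},\qquad M(A)=\{x\in\mathbb B(H): xA\subseteq A,\ Ax\subseteq A\},$$ and consider the following spaces of sequences with termwise operations. - $\ell^2(A)$: the sequences $(a_n)$ in $A$ for which $\sum_n a_na_n^*$ converges in norm in $A$. It is a left Hilbert $A$-module with $\langle (a_n),(b_n)\rangle=\sum_n a_nb_n^*$. - $M(\ell^2(A))$: the sequences $(c_n)$ in $M(A)$ for which $\sum_n c_nc_n^*$ converges strictly in $M(A)$, i.e. in the topology given by the seminorms $x\mapsto\|ax\|$ and $x\mapsto\|xa\|$, $a\in A$. It is a left Hilbert $M(A)$-module with $\langle (c_n),(d_n)\rangle=\sum_n c_nd_n^*$ (strict sum). - $\ell^2_{\rm strong}(LM(A))$: the sequences $(t_n)$ in $LM(A)$ with $\sup_N\|\sum_{n\le N}t_nt_n^*\|<\infty$. For such a sequence $\sum_n t_nt_n^*$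 converges in the strong operator topology, the norm is $\|(t_n)\|=\|\sum_n t_nt_n^*\|^{1/2}$ (strong sum), and $A$ acts by $b(t_n)=(bt_n)$. Let $\ell^2(A)'$ be the space of all bounded linear maps $L:\ell^2(A)\to A$ with $L(ax)=aL(x)$ for $a\in A$, with the operator norm and the right action $(Lm)(x)=L(x)m$ of $M(A)$, and hence of $A$. Let $\ell^2(A)^*\subseteq\ell^2(A)'$ be the subspace of the adjointable maps, i.e. of those $L$ for which there is a map $L^*:A\to\ell^2(A)$ with $L(x)b^*=\langle x,L^*b\rangle$ for all $x\in\ell^2(A)$ and $b\in A$. For $K,L\in\ell^2(A)^*$ the inner product $\langle L,K\rangle\in M(A)$ is defined by $K(L^*a)=a\langle L,K\rangle$ for all $a\in A$. Then $\ell^2(A)\subseteq M(\ell^2(A))\subseteq\ell^2_{\rm strong}(LM(A))$, the spaces $M(\ell^2(A))$ and $\ell^2_{\rm strong}(LM(A))$ are complete, and the following hold. 1. For every $t=(t_n)\in\ell^2_{\rm strong}(LM(A))$ and every $(a_n)\in\ell^2(A)$ the series $L_t((a_n))=\sum_n a_nt_n^*$ converges in norm in $A$, and $\varphi(t)=L_t$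 defines an anti-linear isometric bijection $$\varphi:\ell^2_{\rm strong}(LM(A))\to\ell^2(A)'$$ of Banach $A$-modules: $\varphi(bt)=\varphi(t)b^*$ for all $b\in A$. 2. The restriction of $\varphi$ to $M(\ell^2(A))$ is an anti-linear isometric bijection $M(\ell^2(A))\to\ell^2(A)^*$ of Hilbert $M(A)$-modules: $\varphi(ms)=\varphi(s)m^*$ for all $m\in M(A)$ and $s\in M(\ell^2(A))$, and $\langle\varphi(s),\varphi(t)\rangle=\langle s,t\rangle$ for all $s,t\in M(\ell^2(A))$. 3. For $x\in\ell^2(A)$ the functional $\varphi(x)$ is the map $y\mapsto\langle y,x\rangle$. -/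

import Mathlib

open Filter Topology

set_option linter.unusedSectionVars false

namespace StandardModule

section Strong

variable {H : Type*} [NormedAddCommGroup H] [InnerProductSpace ℂ H] [CompleteSpace H]

/-- The norms of the partial sums of `∑ cₙ cₙ*` are bounded. -/
def HasBoundedSums (c : ℕ → H →L[ℂ] H) : Prop :=
  ∃ C : ℝ, ∀ N : ℕ, ‖∑ n ∈ Finset.range N, c n * star (c n)‖ ≤ C

theorem HasBoundedSums.add {x y : ℕ → H →L[ℂ] H} (hx : HasBoundedSums x)
    (hy : HasBoundedSums y) : HasBoundedSums (x + y) := by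
  obtain ⟨C, hC⟩ := hx
  obtain ⟨D, hD⟩ := hy
  refine ⟨2 * C + 2 * D, fun N => ?_⟩
  have h0 : 0 ≤ ∑ n ∈ Finset.range N, (x + y) n * star ((x + y) n) :=
    Finset.sum_nonneg fun n _ => mul_star_self_nonneg _
  have h1 : ∑ n ∈ Finset.range N, (x + y) n * star ((x + y) n) ≤
      (2 : ℂ) • (∑ n ∈ Finset.range N, x n * star (x n)) +
        (2 : ℂ) • (∑ n ∈ Finset.range N, y n * star (y n)) := by
    have h2 : 0 ≤ ∑ n ∈ Finset.range N, (x - y) n * star ((x - y) n) :=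
      Finset.sum_nonneg fun n _ => mul_star_self_nonneg _
    refine (le_add_of_nonneg_right h2).trans (le_of_eq ?_)
    rw [Finset.smul_sum, Finset.smul_sum, ← Finset.sum_add_distrib, ← Finset.sum_add_distrib]
    refine Finset.sum_congr rfl fun n _ => ?_
    simp only [Pi.add_apply, Pi.sub_apply, star_add, star_sub, two_smul]
    noncomm_ring
  refine (CStarAlgebra.norm_le_norm_of_nonneg_of_le h0 h1).trans ((norm_add_le _ _).trans ?_)
  rw [norm_smul, norm_smul]
  have := hC N
  have := hD N
  norm_num
  linarith

theorem HasBoundedSums.smul {x : ℕ → H →L[ℂ] H} (hx : HasBoundedSums x) (z : ℂ) :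
    HasBoundedSums (z • x) := by
  obtain ⟨C, hC⟩ := hx
  refine ⟨‖z * star z‖ * C, fun N => ?_⟩
  have : ∑ n ∈ Finset.range N, (z • x) n * star ((z • x) n) =
      (z * star z) • ∑ n ∈ Finset.range N, x n * star (x n) := by
    rw [Finset.smul_sum]
    refine Finset.sum_congr rfl fun n _ => ?_
    rw [Pi.smul_apply, star_smul, smul_mul_smul_comm]
  rw [this, norm_smul]
  exact mul_le_mul_of_nonneg_left (hC N) (norm_nonneg _)

theorem HasBoundedSums.mul_left {x : ℕ → H →L[ℂ] H} (hx : HasBoundedSums x) (b : H →L[ℂ] H) :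
    HasBoundedSums (fun n => b * x n) := by
  obtain ⟨C, hC⟩ := hx
  refine ⟨‖b‖ * C * ‖star b‖, fun N => ?_⟩
  have : ∑ n ∈ Finset.range N, (b * x n) * star (b * x n) =
      b * (∑ n ∈ Finset.range N, x n * star (x n)) * star b := by
    rw [Finset.mul_sum, Finset.sum_mul]
    refine Finset.sum_congr rfl fun n _ => ?_
    rw [star_mul]
    noncomm_ring
  rw [this]
  refine (norm_mul_le _ _).trans ?_
  refine mul_le_mul_of_nonneg_right ((norm_mul_le _ _).trans ?_) (norm_nonneg _)
  exact mul_le_mul_of_nonneg_left (hC N) (norm_nonneg _)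

variable (H) in
/-- The space `ℓ²_strong(𝔹(H))` of all sequences of bounded operators on `H` with
`sup_N ‖∑_{n < N} cₙ cₙ*‖ < ∞`. -/
structure StrongSeq where
  /-- The terms of the sequence. -/
  toFun : ℕ → H →L[ℂ] H
  hasBoundedSums : HasBoundedSums toFun

namespace StrongSeq

instance : CoeFun (StrongSeq H) (fun _ => ℕ → H →L[ℂ] H) := ⟨StrongSeq.toFun⟩

theorem toFun_injective : Function.Injective (toFun : StrongSeq H → ℕ → H →L[ℂ] H) := by
  rintro ⟨x, hx⟩ ⟨y, hy⟩ h
  cases h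
  rfl

@[ext] theorem ext {x y : StrongSeq H} (h : ∀ n, x n = y n) : x = y :=
  toFun_injective (funext h)

/-! Addition and multiplication by complex numbers are termwise. -/

instance : Zero (StrongSeq H) := ⟨⟨0, ⟨0, fun N => by simp⟩⟩⟩
instance : Add (StrongSeq H) := ⟨fun x y => ⟨x.toFun + y.toFun, x.2.add y.2⟩⟩
instance : SMul ℂ (StrongSeq H) := ⟨fun z x => ⟨z • x.toFun, x.2.smul z⟩⟩
instance : Neg (StrongSeq H) := ⟨fun x => ⟨-x.toFun, by simpa using x.2.smul (-1)⟩⟩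
instance : Sub (StrongSeq H) :=
  ⟨fun x y => ⟨x.toFun - y.toFun, by simpa [sub_eq_add_neg] using x.2.add (y.2.smul (-1))⟩⟩
instance : SMul ℕ (StrongSeq H) :=
  ⟨fun k x => ⟨k • x.toFun, by
    rw [← Nat.cast_smul_eq_nsmul ℂ]; exact x.2.smul _⟩⟩
instance : SMul ℤ (StrongSeq H) :=
  ⟨fun k x => ⟨k • x.toFun, by
    rw [← Int.cast_smul_eq_zsmul ℂ]; exact x.2.smul _⟩⟩

instance : AddCommGroup (StrongSeq H) :=
  toFun_injective.addCommGroup toFun rfl (fun _ _ => rfl) (fun _ => rfl) (fun _ _ => rfl)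
    (fun _ _ => rfl) (fun _ _ => rfl)

instance : Module ℂ (StrongSeq H) :=
  toFun_injective.module ℂ ⟨⟨toFun, rfl⟩, fun _ _ => rfl⟩ (fun _ _ => rfl)

@[simp] theorem add_apply (x y : StrongSeq H) (n : ℕ) : (x + y) n = x n + y n := rfl
@[simp] theorem smul_apply (z : ℂ) (x : StrongSeq H) (n : ℕ) : (z • x) n = z • x n := rfl
@[simp] theorem zero_apply (n : ℕ) : (0 : StrongSeq H) n = 0 := rfl

/-- Termwise multiplication from the left, `b • (xₙ)ₙ = (b xₙ)ₙ`. -/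
instance : SMul (H →L[ℂ] H) (StrongSeq H) :=
  ⟨fun b x => ⟨fun n => b * x n, HasBoundedSums.mul_left x.2 b⟩⟩

@[simp] theorem op_smul_apply (b : H →L[ℂ] H) (x : StrongSeq H) (n : ℕ) :
    (b • x) n = b * x n := rfl

theorem exists_sum_le (x : StrongSeq H) :
    ∃ C : ℝ, 0 ≤ C ∧ ∀ (s : Finset ℕ) (ξ : H),
      ∑ n ∈ s, ‖star (x n) ξ‖ ^ (2 : ENNReal).toReal ≤ (C * ‖ξ‖) ^ (2 : ENNReal).toReal := by
  obtain ⟨C, hC⟩ := x.hasBoundedSums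
  have hC0 : 0 ≤ C := (norm_nonneg _).trans (hC 0)
  refine ⟨√C, Real.sqrt_nonneg _, fun s ξ => ?_⟩
  obtain ⟨N, hN⟩ := s.exists_nat_subset_range
  simp only [ENNReal.toReal_ofNat, Real.rpow_ofNat]
  rw [mul_pow, Real.sq_sqrt hC0]
  refine (Finset.sum_le_sum_of_subset_of_nonneg hN fun _ _ _ => by positivity).trans ?_
  have h1 : ∑ n ∈ Finset.range N, ‖star (x n) ξ‖ ^ 2 =
      RCLike.re (inner ℂ ((∑ n ∈ Finset.range N, x n * star (x n)) ξ) ξ) := by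
    rw [sum_apply, sum_inner, map_sum]
    refine Finset.sum_congr rfl fun n _ => ?_
    rw [mul_apply_eq_comp, ← ContinuousLinearMap.adjoint_inner_right,
      ← ContinuousLinearMap.star_eq_adjoint, inner_self_eq_norm_sq]
  rw [h1]
  refine (re_inner_le_norm _ _).trans ?_
  have h2 := ContinuousLinearMap.le_opNorm (∑ n ∈ Finset.range N, x n * star (x n)) ξ
  calc _ ≤ ‖∑ n ∈ Finset.range N, x n * star (x n)‖ * ‖ξ‖ * ‖ξ‖ :=
        mul_le_mul_of_nonneg_right h2 (norm_nonneg _)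
    _ ≤ C * ‖ξ‖ * ‖ξ‖ := by gcongr; exact hC N
    _ = C * ‖ξ‖ ^ 2 := by ring

variable (H) in
/-- The Hilbert sum of countably many copies of `H`. -/
def HilbertSum : Type _ := lp (fun _ : ℕ => H) 2

noncomputable instance : NormedAddCommGroup (HilbertSum H) :=
  inferInstanceAs (NormedAddCommGroup (lp (fun _ : ℕ => H) 2))

noncomputable instance : InnerProductSpace ℂ (HilbertSum H) :=
  inferInstanceAs (InnerProductSpace ℂ (lp (fun _ : ℕ => H) 2))

instance : CompleteSpace (HilbertSum H) :=
  inferInstanceAs (CompleteSpace (lp (fun _ : ℕ => H) 2))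

/-- The terms of an element of the Hilbert sum. -/
def HilbertSum.coord (v : HilbertSum H) (n : ℕ) : H :=
  (show lp (fun _ : ℕ => H) 2 from v).1 n

theorem HilbertSum.ext {v w : HilbertSum H} (h : ∀ n, v.coord n = w.coord n) : v = w :=
  lp.ext (funext h)

@[simp] theorem HilbertSum.coord_add (v w : HilbertSum H) (n : ℕ) :
    (v + w).coord n = v.coord n + w.coord n := rfl

@[simp] theorem HilbertSum.coord_smul (z : ℂ) (v : HilbertSum H) (n : ℕ) :
    (z • v).coord n = z • v.coord n := rfl

@[simp] theorem HilbertSum.coord_zero (n : ℕ) : (0 : HilbertSum H).coord n = 0 := rfl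

/-- The vector with the single entry `η` in place `n`. -/
noncomputable def HilbertSum.single (n : ℕ) (η : H) : HilbertSum H :=
  lp.single (E := fun _ : ℕ => H) 2 n η

theorem HilbertSum.hasSum_single (v : HilbertSum H) :
    HasSum (fun n => HilbertSum.single n (v.coord n)) v :=
  lp.hasSum_single (E := fun _ : ℕ => H) (p := 2) (by simp) v

theorem HilbertSum.inner_single (n : ℕ) (η : H) (v : HilbertSum H) :
    inner ℂ (HilbertSum.single n η) v = inner ℂ η (v.coord n) :=
  lp.inner_single_left (G := fun _ : ℕ => H) n η v

/-- The operator `ξ ↦ (xₙ* ξ)ₙ` from `H` to the Hilbert sum of copies of `H`. -/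
noncomputable def col (x : StrongSeq H) : H →L[ℂ] HilbertSum H :=
  LinearMap.mkContinuousOfExistsBound
    { toFun := fun ξ => (⟨fun n => star (x n) ξ,
        memℓp_gen' fun s => x.exists_sum_le.choose_spec.2 s ξ⟩ : lp (fun _ : ℕ => H) 2)
      map_add' := fun ξ η => HilbertSum.ext fun n => map_add (star (x n)) ξ η
      map_smul' := fun z ξ => HilbertSum.ext fun n => map_smul (star (x n)) z ξ }
    ⟨x.exists_sum_le.choose, fun ξ => lp.norm_le_of_forall_sum_le (E := fun _ : ℕ => H) (by simp)
      (mul_nonneg x.exists_sum_le.choose_spec.1 (norm_nonneg _))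
      fun s => x.exists_sum_le.choose_spec.2 s ξ⟩

@[simp] theorem coord_col (x : StrongSeq H) (ξ : H) (n : ℕ) :
    (x.col ξ).coord n = star (x n) ξ := rfl

theorem col_add (x y : StrongSeq H) : (x + y).col = x.col + y.col := by
  refine ContinuousLinearMap.ext fun ξ => HilbertSum.ext fun n => ?_
  simp

theorem col_smul (z : ℂ) (x : StrongSeq H) : (z • x).col = star z • x.col := by
  refine ContinuousLinearMap.ext fun ξ => HilbertSum.ext fun n => ?_
  simp

/-- The operator valued inner product `⟨x, y⟩ = ∑ xₙ yₙ*`, the series being convergent in the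
strong operator topology; see `hasSum_ip`. -/
noncomputable def ip (x y : StrongSeq H) : H →L[ℂ] H :=
  ContinuousLinearMap.adjoint x.col ∘L y.col

theorem hasSum_ip (x y : StrongSeq H) (ξ : H) :
    HasSum (fun n => (x n * star (y n)) ξ) (ip x y ξ) := by
  have h := (HilbertSum.hasSum_single (y.col ξ)).mapL (ContinuousLinearMap.adjoint x.col)
  have h1 : ∀ n, ContinuousLinearMap.adjoint x.col (HilbertSum.single n ((y.col ξ).coord n)) =
      (x n * star (y n)) ξ := fun n => by
    refine ext_inner_right ℂ fun η => ?_
    rw [ContinuousLinearMap.adjoint_inner_left, HilbertSum.inner_single, coord_col, coord_col,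
      ContinuousLinearMap.star_eq_adjoint (x n), ContinuousLinearMap.adjoint_inner_right]
    rfl
  simp only [h1] at h
  exact h

theorem star_ip (x y : StrongSeq H) : star (ip x y) = ip y x := by
  rw [ip, ip, ContinuousLinearMap.star_eq_adjoint, ContinuousLinearMap.adjoint_comp,
    ContinuousLinearMap.adjoint_adjoint]

/-- The norm `‖x‖ = ‖⟨x, x⟩‖^(1/2)` of the inner product module `ℓ²_strong(𝔹(H))`. -/
noncomputable instance : Norm (StrongSeq H) := ⟨fun x => √‖ip x x‖⟩

theorem norm_def (x : StrongSeq H) : ‖x‖ = √‖ip x x‖ := rfl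

theorem norm_eq_norm_col (x : StrongSeq H) : ‖x‖ = ‖x.col‖ := by
  rw [norm_def, ip, ContinuousLinearMap.norm_adjoint_comp_self, Real.sqrt_mul_self (norm_nonneg _)]

theorem normedSpaceCore : NormedSpace.Core ℂ (StrongSeq H) where
  norm_nonneg _ := Real.sqrt_nonneg _
  norm_smul z x := by
    rw [norm_eq_norm_col, norm_eq_norm_col, col_smul, norm_smul, norm_star]
  norm_triangle x y := by
    simp only [norm_eq_norm_col, col_add]
    exact norm_add_le _ _
  norm_eq_zero_iff x := by
    rw [norm_eq_norm_col, norm_eq_zero]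
    constructor
    · intro h
      ext1 n
      rw [zero_apply, ← star_eq_zero]
      ext ξ
      rw [← coord_col, h]
      rfl
    · rintro rfl
      refine ContinuousLinearMap.ext fun ξ => HilbertSum.ext fun n => ?_
      simp

noncomputable instance : NormedAddCommGroup (StrongSeq H) :=
  NormedAddCommGroup.ofCore normedSpaceCore

noncomputable instance : NormedSpace ℂ (StrongSeq H) :=
  NormedSpace.ofCore normedSpaceCore

theorem norm_ip_le (x y : StrongSeq H) : ‖ip x y‖ ≤ ‖x‖ * ‖y‖ := by
  rw [norm_eq_norm_col, norm_eq_norm_col, ip, ← LinearIsometryEquiv.norm_map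
    (ContinuousLinearMap.adjoint (𝕜 := ℂ)) x.col]
  exact ContinuousLinearMap.opNorm_comp_le _ _

theorem ip_add_left (x y z : StrongSeq H) : ip (x + y) z = ip x z + ip y z := by
  rw [ip, col_add, map_add, ContinuousLinearMap.add_comp]; rfl

theorem ip_add_right (x y z : StrongSeq H) : ip x (y + z) = ip x y + ip x z := by
  rw [ip, col_add, ContinuousLinearMap.comp_add]; rfl

theorem ip_smul_right (z : ℂ) (x y : StrongSeq H) : ip x (z • y) = star z • ip x y := by
  rw [ip, col_smul, ContinuousLinearMap.comp_smul]; rfl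

theorem ip_smul_left (z : ℂ) (x y : StrongSeq H) : ip (z • x) y = z • ip x y := by
  rw [← star_ip, ip_smul_right, star_smul, star_star, star_ip]

theorem ip_op_smul_left (b : H →L[ℂ] H) (x y : StrongSeq H) : ip (b • x) y = b * ip x y := by
  ext ξ
  refine (hasSum_ip (b • x) y ξ).unique ?_
  simpa [mul_assoc] using (hasSum_ip x y ξ).mapL b

/-- The sequence that agrees with `x` on the finite set `s` and vanishes elsewhere. -/
noncomputable def trunc (s : Finset ℕ) (x : StrongSeq H) : StrongSeq H where
  toFun n := if n ∈ s then x n else 0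
  hasBoundedSums := by
    obtain ⟨C, hC⟩ := x.hasBoundedSums
    refine ⟨C, fun N => (CStarAlgebra.norm_le_norm_of_nonneg_of_le
      (Finset.sum_nonneg fun n _ => mul_star_self_nonneg _)
      (Finset.sum_le_sum fun n _ => ?_)).trans (hC N)⟩
    by_cases h : n ∈ s <;> simp [h, mul_star_self_nonneg]

theorem ip_trunc (s : Finset ℕ) (x y : StrongSeq H) :
    ip (trunc s x) (trunc s y) = ∑ n ∈ s, x n * star (y n) := by
  ext ξ
  refine (hasSum_ip _ _ ξ).unique ?_
  have h := hasSum_sum_of_ne_finset_zero (s := s) (L := SummationFilter.unconditional ℕ)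
    (f := fun n => ((trunc s x) n * star ((trunc s y) n)) ξ) (fun n hn => by simp [trunc, hn])
  convert h using 1
  rw [sum_apply]
  exact Finset.sum_congr rfl fun n hn => by simp [trunc, hn]

/-- The Cauchy-Schwarz inequality for finite sums. -/
theorem norm_sum_mul_star_le (s : Finset ℕ) (x y : StrongSeq H) :
    ‖∑ n ∈ s, x n * star (y n)‖ ≤
      √‖∑ n ∈ s, x n * star (x n)‖ * √‖∑ n ∈ s, y n * star (y n)‖ := by
  have h := norm_ip_le (trunc s x) (trunc s y)
  rwa [norm_def, norm_def, ip_trunc, ip_trunc, ip_trunc] at h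

/-- If `∑ xₙ xₙ*` converges in norm, then so does `∑ xₙ yₙ*`. -/
theorem tendsto_ip (x y : StrongSeq H)
    (hx : CauchySeq fun N => ∑ n ∈ Finset.range N, x n * star (x n)) :
    Tendsto (fun N => ∑ n ∈ Finset.range N, x n * star (y n)) atTop (𝓝 (ip x y)) := by
  obtain ⟨C, hC⟩ := y.hasBoundedSums
  have hC0 : 0 ≤ C := (norm_nonneg _).trans (hC 0)
  have hc : CauchySeq fun N => ∑ n ∈ Finset.range N, x n * star (y n) := by
    rw [Metric.cauchySeq_iff'] at hx ⊢
    intro ε hε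
    obtain ⟨N, hN⟩ := hx (ε ^ 2 / (C + 1)) (by positivity)
    refine ⟨N, fun n hn => ?_⟩
    have h1 := hN n hn
    rw [dist_eq_norm, ← Finset.sum_Ico_eq_sub _ hn] at h1 ⊢
    have h2 : ‖∑ k ∈ Finset.Ico N n, y k * star (y k)‖ ≤ C := by
      refine (CStarAlgebra.norm_le_norm_of_nonneg_of_le
        (Finset.sum_nonneg fun n _ => mul_star_self_nonneg _)
        (Finset.sum_le_sum_of_subset_of_nonneg (t := Finset.range n) ?_
          fun n _ _ => mul_star_self_nonneg _)).trans (hC n)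
      intro k hk
      simp at hk ⊢
      exact hk.2
    refine (norm_sum_mul_star_le _ x y).trans_lt ?_
    rw [← Real.sqrt_mul (norm_nonneg _), Real.sqrt_lt' hε]
    calc _ ≤ ‖∑ k ∈ Finset.Ico N n, x k * star (x k)‖ * (C + 1) := by
          gcongr; linarith
      _ < ε ^ 2 / (C + 1) * (C + 1) := by gcongr
      _ = ε ^ 2 := by field_simp
  obtain ⟨T, hT⟩ := cauchySeq_tendsto_of_complete hc
  have : T = ip x y := by
    ext ξ
    refine tendsto_nhds_unique (f := fun N => (∑ n ∈ Finset.range N, x n * star (y n)) ξ) ?_ ?_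
      (l := atTop)
    · exact ((ContinuousLinearMap.apply ℂ H ξ).continuous.tendsto T).comp hT
    · simpa only [sum_apply] using (hasSum_ip x y ξ).tendsto_sum_nat
  rwa [← this]

end StrongSeq

end Strong


/-- The dual `X′` of a left module `X` over a C*-algebra `A`: the bounded linear maps `L : X → A`
with `L (a x) = a L(x)`, with the operator norm. -/
def moduleDual (A X : Type*) [NonUnitalCStarAlgebra A] [NormedAddCommGroup X] [NormedSpace ℂ X]
    [SMul A X] : Submodule ℂ (X →L[ℂ] A) where
  carrier := {L | ∀ (a : A) (x : X), L (a • x) = a * L x}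
  add_mem' hL hK a x := by
    simp only [add_apply, hL a x, hK a x, mul_add]
  zero_mem' a x := by simp
  smul_mem' z L hL a x := by
    simp only [smul_apply, hL a x, mul_smul_comm]

section ModuleDual

variable (A X : Type*) [NonUnitalCStarAlgebra A] [NormedAddCommGroup X] [NormedSpace ℂ X] [SMul A X]

/-- The dual `X′` as a type. -/
def ModuleDual : Type _ := moduleDual A X

noncomputable instance : NormedAddCommGroup (ModuleDual A X) :=
  inferInstanceAs (NormedAddCommGroup (moduleDual A X))

noncomputable instance : NormedSpace ℂ (ModuleDual A X) :=
  inferInstanceAs (NormedSpace ℂ (moduleDual A X))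

instance : FunLike (ModuleDual A X) X A where
  coe L := (show moduleDual A X from L).1
  coe_injective _ _ h := Subtype.ext (DFunLike.coe_injective h)

variable {A X}

theorem ModuleDual.add_apply (L K : ModuleDual A X) (x : X) : (L + K) x = L x + K x := rfl
theorem ModuleDual.smul_apply (z : ℂ) (L : ModuleDual A X) (x : X) : (z • L) x = z • L x := rfl
theorem ModuleDual.zero_apply (x : X) : (0 : ModuleDual A X) x = 0 := rfl
theorem ModuleDual.map_op_smul (L : ModuleDual A X) (a : A) (x : X) : L (a • x) = a * L x :=
  (show moduleDual A X from L).2 a x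

end ModuleDual

section Algebra

variable {H : Type*} [NormedAddCommGroup H] [InnerProductSpace ℂ H] [CompleteSpace H]
variable (A : NonUnitalStarSubalgebra ℂ (H →L[ℂ] H))

/-- `A` acts non-degenerately on `H`: the vectors `a ξ` span a dense subspace. -/
def ActsNondegenerately : Prop :=
  (Submodule.span ℂ {η : H | ∃ a ∈ A, ∃ ξ : H, a ξ = η}).topologicalClosure = ⊤

/-- The left multipliers `LM(A)`: the operators `x` on `H` with `x A ⊆ A`. -/
def leftMultipliers : Subalgebra ℂ (H →L[ℂ] H) where
  carrier := {x | ∀ a ∈ A, x * a ∈ A}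
  mul_mem' {x y} hx hy a ha := by
    rw [mul_assoc]; exact hx _ (hy a ha)
  add_mem' {x y} hx hy a ha := by
    rw [add_mul]; exact add_mem (hx a ha) (hy a ha)
  algebraMap_mem' z a ha := by
    rw [← Algebra.smul_def]; exact A.smul_mem' z ha

/-- The multiplier algebra `M(A)`: the operators `x` on `H` with `x A ⊆ A` and `A x ⊆ A`. -/
def multipliers : StarSubalgebra ℂ (H →L[ℂ] H) where
  carrier := {x | ∀ a ∈ A, x * a ∈ A ∧ a * x ∈ A}
  mul_mem' {x y} hx hy a ha := by
    constructor
    · rw [mul_assoc]; exact (hx _ (hy a ha).1).1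
    · rw [← mul_assoc]; exact (hy _ (hx a ha).2).2
  add_mem' {x y} hx hy a ha := by
    rw [add_mul, mul_add]
    exact ⟨add_mem (hx a ha).1 (hy a ha).1, add_mem (hx a ha).2 (hy a ha).2⟩
  algebraMap_mem' z a ha := by
    rw [← Algebra.smul_def, ← Algebra.commutes, ← Algebra.smul_def]
    exact ⟨A.smul_mem' z ha, A.smul_mem' z ha⟩
  star_mem' {x} hx a ha := by
    have h := hx (star a) (star_mem ha)
    constructor
    · simpa using star_mem h.2
    · simpa using star_mem h.1

theorem mem_multipliers {x : H →L[ℂ] H} (hx : x ∈ A) : x ∈ multipliers A :=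
  fun _ ha => ⟨mul_mem hx ha, mul_mem ha hx⟩

/-- The inclusion of `A` into `M(A)`. -/
def toMultiplier (a : A) : multipliers A := ⟨a, mem_multipliers A a.2⟩

/-- `s` is the sum of the series `∑ cₙ` in the strict topology given by `A`, which is generated by
the seminorms `x ↦ ‖a x‖` and `x ↦ ‖x a‖`, `a ∈ A`. -/
def IsStrictSum (c : ℕ → H →L[ℂ] H) (s : H →L[ℂ] H) : Prop :=
  ∀ a ∈ A, Tendsto (fun N => a * ∑ n ∈ Finset.range N, c n) atTop (𝓝 (a * s)) ∧
    Tendsto (fun N => (∑ n ∈ Finset.range N, c n) * a) atTop (𝓝 (s * a))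

/-- The sequences `(cₙ)` in `M(A)` for which `∑ cₙ cₙ*` converges strictly in `M(A)`. -/
def IsMultSeq (c : ℕ → H →L[ℂ] H) : Prop :=
  (∀ n, c n ∈ multipliers A) ∧ ∃ s ∈ multipliers A, IsStrictSum A (fun n => c n * star (c n)) s

/-- The sequences `(aₙ)` in `A` for which `∑ aₙ aₙ*` converges in norm in `A`. -/
def IsEllTwo (a : ℕ → H →L[ℂ] H) : Prop :=
  (∀ n, a n ∈ A) ∧
    ∃ s ∈ A, Tendsto (fun N => ∑ n ∈ Finset.range N, a n * star (a n)) atTop (𝓝 s)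

variable {A}

/-- Membership in `ℓ²_strong(𝔹(H))` is no restriction on the sequences in `ℓ²(A)`. -/
theorem IsEllTwo.hasBoundedSums {a : ℕ → H →L[ℂ] H} (ha : IsEllTwo A a) : HasBoundedSums a := by
  obtain ⟨s, -, hs⟩ := ha.2
  obtain ⟨C, hC⟩ := hs.norm.bddAbove_range
  exact ⟨C, fun N => hC ⟨N, rfl⟩⟩

theorem IsEllTwo.tendsto_ip {x : StrongSeq H} (hx : IsEllTwo A x) (y : StrongSeq H) :
    Tendsto (fun N => ∑ n ∈ Finset.range N, x n * star (y n)) atTop (𝓝 (x.ip y)) :=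
  StrongSeq.tendsto_ip x y hx.2.choose_spec.2.cauchySeq

theorem IsMultSeq.tendsto_ip {x : StrongSeq H} (hx : IsMultSeq A x) (y : StrongSeq H)
    {a : H →L[ℂ] H} (ha : a ∈ A) :
    Tendsto (fun N => a * ∑ n ∈ Finset.range N, x n * star (y n)) atTop (𝓝 (a * x.ip y)) := by
  obtain ⟨s, -, hs⟩ := hx.2
  have h1 : CauchySeq fun N => ∑ n ∈ Finset.range N, (a • x) n * star ((a • x) n) := by
    refine (((hs a ha).1.mul_const (star a)).congr fun N => ?_).cauchySeq
    rw [Finset.mul_sum, Finset.sum_mul]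
    refine Finset.sum_congr rfl fun n _ => ?_
    simp [mul_assoc]
  have h2 := StrongSeq.tendsto_ip (a • x) y h1
  rw [StrongSeq.ip_op_smul_left] at h2
  refine h2.congr fun N => ?_
  rw [Finset.mul_sum]
  exact Finset.sum_congr rfl fun n _ => by simp [mul_assoc]

/-- On sequences with strictly convergent `∑ cₙ cₙ*` the inner product is the strict sum. -/
theorem IsMultSeq.isStrictSum_ip {x y : StrongSeq H} (hx : IsMultSeq A x) (hy : IsMultSeq A y) :
    IsStrictSum A (fun n => x n * star (y n)) (x.ip y) := by
  intro a ha
  refine ⟨hx.tendsto_ip y ha, ?_⟩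
  have h := (hy.tendsto_ip x (star_mem ha)).star
  rw [star_mul, StrongSeq.star_ip, star_star] at h
  refine h.congr fun N => ?_
  rw [star_mul, star_star, star_sum]
  congr 1
  exact Finset.sum_congr rfl fun n _ => by simp

section Closed

variable [hA : IsClosed (A : Set (H →L[ℂ] H))]

theorem IsEllTwo.ip_mem {x y : StrongSeq H} (hx : IsEllTwo A x) (hy : IsEllTwo A y) :
    x.ip y ∈ A :=
  hA.mem_of_tendsto (hx.tendsto_ip y)
    (Eventually.of_forall fun _ => sum_mem fun n _ => mul_mem (hx.1 n) (star_mem (hy.1 n)))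

theorem IsMultSeq.ip_mem {x y : StrongSeq H} (hx : IsMultSeq A x) (hy : IsMultSeq A y) :
    x.ip y ∈ multipliers A := by
  have h0 : ∀ N, ∑ n ∈ Finset.range N, x n * star (y n) ∈ multipliers A := fun N =>
    sum_mem fun n _ => mul_mem (hx.1 n) (star_mem (hy.1 n))
  intro a ha
  have h := hx.isStrictSum_ip hy a ha
  exact ⟨hA.mem_of_tendsto h.2 (Eventually.of_forall fun N => (h0 N a ha).1),
    hA.mem_of_tendsto h.1 (Eventually.of_forall fun N => (h0 N a ha).2)⟩

end Closed

variable (A)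

/-- `ℓ²_strong(LM(A))`, the sequences `(tₙ)` in `LM(A)` with `sup_N ‖∑_{n < N} tₙ tₙ*‖ < ∞`, with
the norm of `ℓ²_strong(𝔹(H))`. -/
def strongLM : Submodule ℂ (StrongSeq H) where
  carrier := {t | ∀ n, t n ∈ leftMultipliers A}
  add_mem' hx hy n := add_mem (hx n) (hy n)
  zero_mem' _ := zero_mem _
  smul_mem' z _ hx n := Subalgebra.smul_mem _ (hx n) z

variable [hA : IsClosed (A : Set (H →L[ℂ] H))]

/-- The multiplier module `M(ℓ²(A))`. -/
def multModule : Submodule ℂ (StrongSeq H) where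
  carrier := {c | IsMultSeq A c}
  add_mem' {x y} hx hy := by
    have hxx := hx.isStrictSum_ip hx
    have hxy := hx.isStrictSum_ip hy
    have hyx := hy.isStrictSum_ip hx
    have hyy := hy.isStrictSum_ip hy
    refine ⟨fun n => add_mem (hx.1 n) (hy.1 n), x.ip x + x.ip y + (y.ip x + y.ip y),
      add_mem (add_mem (hx.ip_mem hx) (hx.ip_mem hy))
        (add_mem (hy.ip_mem hx) (hy.ip_mem hy)), fun a ha => ⟨?_, ?_⟩⟩
    · have h := (((hxx a ha).1.add (hxy a ha).1).add ((hyx a ha).1.add (hyy a ha).1))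
      simp only [← mul_add, ← Finset.sum_add_distrib] at h
      refine h.congr fun N => ?_
      congr 1
      refine Finset.sum_congr rfl fun n _ => ?_
      simp only [StrongSeq.add_apply, star_add]
      noncomm_ring
    · have h := (((hxx a ha).2.add (hxy a ha).2).add ((hyx a ha).2.add (hyy a ha).2))
      simp only [← add_mul, ← Finset.sum_add_distrib] at h
      refine h.congr fun N => ?_
      congr 1
      refine Finset.sum_congr rfl fun n _ => ?_
      simp only [StrongSeq.add_apply, star_add]
      noncomm_ring
  zero_mem' := ⟨fun _ => zero_mem _, 0, zero_mem _, fun a _ => by simp⟩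
  smul_mem' z x hx := by
    have hxx := hx.isStrictSum_ip hx
    refine ⟨fun n => (multipliers A).smul_mem (hx.1 n) z, (z * star z) • x.ip x,
      (multipliers A).smul_mem (hx.ip_mem hx) _, fun a ha => ⟨?_, ?_⟩⟩
    · have h := (hxx a ha).1.const_smul (z * star z)
      simp only [← mul_smul_comm, Finset.smul_sum] at h
      refine h.congr fun N => ?_
      congr 1
      refine Finset.sum_congr rfl fun n _ => ?_
      simp [smul_smul, mul_comm]
    · have h := (hxx a ha).2.const_smul (z * star z)
      simp only [← smul_mul_assoc, Finset.smul_sum] at h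
      refine h.congr fun N => ?_
      congr 1
      refine Finset.sum_congr rfl fun n _ => ?_
      simp [smul_smul, mul_comm]

/-- The standard Hilbert module `ℓ²(A)`. -/
def ellTwo : Submodule ℂ (StrongSeq H) where
  carrier := {a | IsEllTwo A a}
  add_mem' {x y} hx hy := by
    refine ⟨fun n => add_mem (hx.1 n) (hy.1 n), x.ip x + x.ip y + (y.ip x + y.ip y),
      add_mem (add_mem (hx.ip_mem hx) (hx.ip_mem hy))
        (add_mem (hy.ip_mem hx) (hy.ip_mem hy)), ?_⟩
    have h := (((hx.tendsto_ip x).add (hx.tendsto_ip y)).add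
      ((hy.tendsto_ip x).add (hy.tendsto_ip y)))
    simp only [← Finset.sum_add_distrib] at h
    refine h.congr fun N => ?_
    refine Finset.sum_congr rfl fun n _ => ?_
    simp only [StrongSeq.add_apply, star_add]
    noncomm_ring
  zero_mem' := ⟨fun _ => zero_mem _, 0, zero_mem _, by simp⟩
  smul_mem' z x hx := by
    refine ⟨fun n => A.smul_mem' z (hx.1 n), (z * star z) • x.ip x,
      A.smul_mem' _ (hx.ip_mem hx), ?_⟩
    have h := (hx.tendsto_ip x).const_smul (z * star z)
    simp only [Finset.smul_sum] at h
    refine h.congr fun N => ?_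
    refine Finset.sum_congr rfl fun n _ => ?_
    rw [StrongSeq.smul_apply, star_smul, smul_mul_smul_comm]

theorem ellTwo_le_multModule : ellTwo A ≤ multModule A := by
  rintro x ⟨h1, s, hs, h⟩
  exact ⟨fun n => mem_multipliers A (h1 n), s, mem_multipliers A hs,
    fun a _ => ⟨h.const_mul a, h.mul_const a⟩⟩

theorem multModule_le_strongLM : multModule A ≤ strongLM A :=
  fun _ hx n a ha => (hx.1 n a ha).1

variable {A}

/-- The `A`-valued inner product `⟨x, y⟩ = ∑ xₙ yₙ*` of `ℓ²(A)`; see `tendsto_ellTwoInner`. -/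
noncomputable def ellTwoInner (x y : ellTwo A) : A := ⟨x.1.ip y.1, IsEllTwo.ip_mem x.2 y.2⟩

theorem tendsto_ellTwoInner (x y : ellTwo A) :
    Tendsto (fun N => ∑ n ∈ Finset.range N, x.1 n * star (y.1 n)) atTop
      (𝓝 (ellTwoInner x y : H →L[ℂ] H)) :=
  IsEllTwo.tendsto_ip x.2 y.1

/-- The `M(A)`-valued inner product `⟨x, y⟩ = ∑ xₙ yₙ*` (strict sum) of `M(ℓ²(A))`; see
`isStrictSum_multInner`. -/
noncomputable def multInner (x y : multModule A) : multipliers A :=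
  ⟨x.1.ip y.1, IsMultSeq.ip_mem x.2 y.2⟩

theorem isStrictSum_multInner (x y : multModule A) :
    IsStrictSum A (fun n => x.1 n * star (y.1 n)) (multInner x y) :=
  IsMultSeq.isStrictSum_ip x.2 y.2

/-! The left actions are termwise multiplications. -/

/-- The left action of `A` on `ℓ²_strong(LM(A))`. -/
instance : SMul A (strongLM A) :=
  ⟨fun b t => ⟨(b : H →L[ℂ] H) • t.1, fun n a ha => by
    rw [StrongSeq.op_smul_apply, mul_assoc]
    exact mul_mem b.2 (t.2 n a ha)⟩⟩

/-- The left action of `A` on `ℓ²(A)`. -/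
instance : SMul A (ellTwo A) :=
  ⟨fun b x => ⟨(b : H →L[ℂ] H) • x.1, fun n => mul_mem b.2 (x.2.1 n),
    (b : H →L[ℂ] H) * x.1.ip x.1 * star (b : H →L[ℂ] H), mul_mem (mul_mem b.2 (IsEllTwo.ip_mem x.2 x.2)) (star_mem b.2), by
      refine (((IsEllTwo.tendsto_ip x.2 x.1).const_mul (b : H →L[ℂ] H)).mul_const
        (star (b : H →L[ℂ] H))).congr fun N => ?_
      rw [Finset.mul_sum, Finset.sum_mul]
      exact Finset.sum_congr rfl fun n _ => by simp [mul_assoc]⟩⟩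

/-- The left action of `M(A)` on `M(ℓ²(A))`. -/
instance : SMul (multipliers A) (multModule A) :=
  ⟨fun m x => ⟨(m : H →L[ℂ] H) • x.1, fun n => mul_mem m.2 (x.2.1 n),
    (m : H →L[ℂ] H) * x.1.ip x.1 * star (m : H →L[ℂ] H), mul_mem (mul_mem m.2 (IsMultSeq.ip_mem x.2 x.2)) (star_mem m.2), by
      have h := IsMultSeq.isStrictSum_ip x.2 x.2
      have h0 : ∀ N, ∑ n ∈ Finset.range N, ((m : H →L[ℂ] H) • x.1) n *
          star (((m : H →L[ℂ] H) • x.1) n) =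
          m * (∑ n ∈ Finset.range N, x.1 n * star (x.1 n)) * star (m : H →L[ℂ] H) := fun N => by
        rw [Finset.mul_sum, Finset.sum_mul]
        exact Finset.sum_congr rfl fun n _ => by simp [mul_assoc]
      intro a ha
      constructor
      · have h1 := ((h _ (m.2 a ha).2).1).mul_const (star (m : H →L[ℂ] H))
        simp only [mul_assoc] at h1 h0 ⊢
        simpa only [h0] using h1
      · have h1 := ((h _ ((star_mem m.2) a ha).1).2).const_mul (m : H →L[ℂ] H)
        simp only [mul_assoc] at h1 h0 ⊢
        simpa only [h0, mul_assoc] using h1⟩⟩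

/-- The dual `ℓ²(A)′`. -/
abbrev Dual (A : NonUnitalStarSubalgebra ℂ (H →L[ℂ] H))
    [hA : IsClosed (A : Set (H →L[ℂ] H))] : Type _ :=
  ModuleDual A (ellTwo A)

/-- Multiplication of elements of `A` by the multiplier `m` from the right. -/
noncomputable def mulRightCLM (m : multipliers A) : A →L[ℂ] A :=
  LinearMap.mkContinuous
    { toFun := fun a => ⟨a * m, (m.2 a a.2).2⟩
      map_add' := fun a b => Subtype.ext (add_mul (a : H →L[ℂ] H) b m)
      map_smul' := fun z a => Subtype.ext (smul_mul_assoc z (a : H →L[ℂ] H) m) }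
    ‖m‖ fun a => (norm_mul_le (a : H →L[ℂ] H) m).trans_eq (mul_comm _ _)

/-- The right action of `M(A)`, and hence of `A`, on `ℓ²(A)′`: `(L m)(x) = L(x) m`. -/
noncomputable def dualMul (L : Dual A) (m : multipliers A) : Dual A :=
  (⟨mulRightCLM m ∘L (show moduleDual A (ellTwo A) from L).1, fun a x => Subtype.ext <| by
    change ((L (a • x) : A) : H →L[ℂ] H) * m = a * ((L x : A) * m)
    rw [ModuleDual.map_op_smul, ← mul_assoc]; rfl⟩ : moduleDual A (ellTwo A))

theorem dualMul_apply (L : Dual A) (m : multipliers A) (x : ellTwo A) :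
    (dualMul L m x : H →L[ℂ] H) = L x * m := rfl

/-- `R` is an adjoint of `L`: `⟨L x, b⟩ = ⟨x, R b⟩`, where `⟨a, b⟩ = a b*` on `A`. -/
def IsAdjoint (L : ellTwo A → A) (R : A → ellTwo A) : Prop :=
  ∀ (x : ellTwo A) (b : A), L x * star b = ellTwoInner x (R b)

/-- The adjointable dual `ℓ²(A)*`. -/
def adjointableDual (A : NonUnitalStarSubalgebra ℂ (H →L[ℂ] H))
    [hA : IsClosed (A : Set (H →L[ℂ] H))] : Submodule ℂ (Dual A) where
  carrier := {L | ∃ R, IsAdjoint L R}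
  add_mem' := by
    rintro L K ⟨R, hR⟩ ⟨S, hS⟩
    refine ⟨fun b => R b + S b, fun x b => Subtype.ext ?_⟩
    have h1 := congrArg Subtype.val (hR x b)
    have h2 := congrArg Subtype.val (hS x b)
    change ((L x : A) + (K x : A) : H →L[ℂ] H) * star (b : H →L[ℂ] H) =
      x.1.ip ((R b).1 + (S b).1)
    rw [add_mul, StrongSeq.ip_add_right]
    exact congrArg₂ (· + ·) h1 h2
  zero_mem' := ⟨fun _ => 0, fun x b => Subtype.ext <| by
    have h := StrongSeq.ip_smul_right 0 x.1 0
    rw [smul_zero, star_zero, zero_smul] at h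
    change (0 : H →L[ℂ] H) * star (b : H →L[ℂ] H) = x.1.ip 0
    rw [zero_mul, h]⟩
  smul_mem' z L := by
    rintro ⟨R, hR⟩
    refine ⟨fun b => star z • R b, fun x b => Subtype.ext ?_⟩
    have h1 := congrArg Subtype.val (hR x b)
    change (z • (L x : A) : H →L[ℂ] H) * star (b : H →L[ℂ] H) = x.1.ip (star z • (R b).1)
    rw [StrongSeq.ip_smul_right, star_star, smul_mul_assoc]
    exact congrArg (z • ·) h1

/-- `m` is the `M(A)`-valued inner product of `L` and `K` in `ℓ²(A)*`: the adjointable operator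
`K L*` on `A` is the multiplication by `m` from the right. -/
def IsDualInner (L K : adjointableDual A) (m : multipliers A) : Prop :=
  ∃ R, IsAdjoint L.1 R ∧ ∀ a : A, (K.1 (R a) : H →L[ℂ] H) = a * m

end Algebra

end StandardModule

/-! A sequence `x` is encoded by its column operator `x.col`, which sends `ξ` to `(xₙ* ξ)ₙ`. Then
`ip x y = x.col* ∘ y.col` and `‖x‖ = ‖x.col‖`, so the Cauchy-Schwarz inequality holds. It makes `∑
xₙ tₙ*` norm convergent for `x` in `ℓ²(A)` and gives `‖L_t‖ ≤ ‖t‖`.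

The reverse inequality (`norm_le_of_ip`) comes from testing `L_t` on `(tₙ e)` for `n < N`, with `e`
from a contractive approximate unit of `A`. This sequence lies in `ℓ²(A)` because `tₙ` is a left
multiplier, its norm is at most `‖t‖`, and its image `∑ tₙ e tₙ*` tends strongly to `∑ tₙ tₙ*`.
Hence `‖t‖² ≤ ‖L_t‖ ‖t‖`.

For surjectivity, a functional `L` restricted to the `n`-th coordinate has the form `a ↦ a Tₙ*` with
`Tₙ` in `LM(A)`, because non-degeneracy makes every bounded right `A`-linear map on `A` a left
multiplication (`exists_leftMultiplier`). The reverse inequality, applied to truncations of `T`,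
bounds the partial sums of `∑ Tₙ Tₙ*` by `‖L‖²`, and density of the finite sequences gives `L =
L_T`.

The adjointable case rests on `mem_multModule_iff`: `t` belongs to `M(ℓ²(A))` exactly when `A t ⊆
ℓ²(A)`. Since `L_t(x) b* = ⟨x, b t⟩`, an adjoint of `L_t` must be `b ↦ b t`, and it exists exactly
under this condition. -/

namespace StandardModule

/-! ### Approximate units and multipliers of a non-degenerate algebra -/

section Nondegenerate

variable {H : Type*} [NormedAddCommGroup H] [InnerProductSpace ℂ H] [CompleteSpace H]
variable {A : NonUnitalStarSubalgebra ℂ (H →L[ℂ] H)}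

/-- A bounded net of operators that converges pointwise to the identity on the vectors `a ξ` does so
everywhere. -/
theorem ActsNondegenerately.tendsto_apply (hnd : ActsNondegenerately A) {ι : Type*} {l : Filter ι}
    {e : ι → H →L[ℂ] H} (he : ∀ᶠ i in l, ‖e i‖ ≤ 1)
    (h : ∀ a ∈ A, Tendsto (fun i => e i * a) l (𝓝 a)) (ξ : H) :
    Tendsto (fun i => e i ξ) l (𝓝 ξ) := by
  have h1 : ∀ η ∈ Submodule.span ℂ {η : H | ∃ a ∈ A, ∃ ξ : H, a ξ = η},
      Tendsto (fun i => e i η) l (𝓝 η) := by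
    intro η hη
    induction hη using Submodule.span_induction with
    | mem η hη =>
      obtain ⟨a, ha, ζ, rfl⟩ := hη
      exact ((ContinuousLinearMap.apply ℂ H ζ).continuous.tendsto a).comp (h a ha)
    | zero => simpa using tendsto_const_nhds
    | add x y _ _ hx hy => simpa using hx.add hy
    | smul z x _ hx => simpa using hx.const_smul z
  have h2 : ξ ∈ closure (Submodule.span ℂ {η : H | ∃ a ∈ A, ∃ ξ : H, a ξ = η} : Set H) := by
    rw [← Submodule.topologicalClosure_coe, hnd]
    trivial
  rw [Metric.tendsto_nhds]
  intro ε hε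
  obtain ⟨η, hη, hd⟩ := Metric.mem_closure_iff.1 h2 (ε / 3) (by positivity)
  filter_upwards [he, Metric.tendsto_nhds.1 (h1 η hη) (ε / 3) (by positivity)] with i hi hi'
  have h3 : dist (e i ξ) (e i η) ≤ dist ξ η := by
    rw [dist_eq_norm, dist_eq_norm, ← map_sub]
    exact ((e i).le_opNorm _).trans (mul_le_of_le_one_left (norm_nonneg _) hi)
  have := dist_triangle4 (e i ξ) (e i η) η ξ
  rw [dist_comm η ξ] at this
  linarith

variable [hA : IsClosed (A : Set (H →L[ℂ] H))]

/-- One filter serves both limits needed later: norm convergence on `A`, and, by non-degeneracy and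
contractivity, strong convergence to the identity on `H`. -/
theorem ActsNondegenerately.exists_approximateUnit (hnd : ActsNondegenerately A) :
    ∃ l : Filter A, l.NeBot ∧ (∀ᶠ e : A in l, ‖(e : H →L[ℂ] H)‖ ≤ 1) ∧
      (∀ a : A, Tendsto (fun e => e * a) l (𝓝 a)) ∧
      (∀ ξ : H, Tendsto (fun e : A => (e : H →L[ℂ] H) ξ) l (𝓝 ξ)) := by
  -- The increasing approximate unit refers to an order on `A`; the spectral order supplies it.
  let _ : PartialOrder A := CStarAlgebra.spectralOrder A
  have : StarOrderedRing A := CStarAlgebra.spectralOrderedRing A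
  have h := CStarAlgebra.increasingApproximateUnit A
  refine ⟨_, h.neBot, h.eventually_norm, h.tendsto_mul_right,
    hnd.tendsto_apply h.eventually_norm fun a ha => ?_⟩
  exact (continuous_subtype_val.tendsto _).comp (h.tendsto_mul_right ⟨a, ha⟩)

/-- The norm of an operator is determined by its products with the elements of `A`. -/
theorem ActsNondegenerately.norm_le_of_mul (hnd : ActsNondegenerately A) {x : H →L[ℂ] H} {C : ℝ}
    (hC : 0 ≤ C) (h : ∀ a ∈ A, ‖x * a‖ ≤ C * ‖a‖) : ‖x‖ ≤ C := by
  obtain ⟨l, _, hl, -, hξ⟩ := hnd.exists_approximateUnit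
  refine x.opNorm_le_bound hC fun ξ => ?_
  -- `x ξ` is the limit of `x e ξ`, and `‖x e‖ ≤ C` for contractive `e`.
  refine le_of_tendsto ((x.continuous.tendsto ξ).comp (hξ ξ)).norm ?_
  filter_upwards [hl] with e he
  refine ((x * (e : H →L[ℂ] H)).le_opNorm ξ).trans ?_
  gcongr
  exact (h e e.2).trans (mul_le_of_le_one_right hC he)

/-- A bounded right `A`-linear map `A → A` is the multiplication by a left multiplier. -/
theorem ActsNondegenerately.exists_leftMultiplier (hnd : ActsNondegenerately A) (M : A →L[ℂ] A)
    (hM : ∀ a b, M (a * b) = M a * b) :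
    ∃ T ∈ leftMultipliers A, ∀ a : A, (M a : H →L[ℂ] H) = T * a := by
  obtain ⟨l, _, hl, hla, -⟩ := hnd.exists_approximateUnit
  -- On formal sums of pairs `(a, ξ)`, `P` is `∑ a ξ` and `Q` is `∑ M(a) ξ`. The multiplier has to
  -- satisfy `T ∘ P = Q`, which determines it on the dense range of `P`.
  let P : (A →₀ H) →ₗ[ℂ] H := Finsupp.lsum ℂ fun a : A => (a : H →L[ℂ] H).toLinearMap
  let Q : (A →₀ H) →ₗ[ℂ] H := Finsupp.lsum ℂ fun a : A => (M a : H →L[ℂ] H).toLinearMap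
  have hP : ∀ a ξ, P (Finsupp.single a ξ) = (a : H →L[ℂ] H) ξ := fun a ξ => by simp [P]
  have hQ : ∀ a ξ, Q (Finsupp.single a ξ) = (M a : H →L[ℂ] H) ξ := fun a ξ => by simp [Q]
  have hd : DenseRange P := by
    have h1 : Submodule.span ℂ {η : H | ∃ a ∈ A, ∃ ξ : H, a ξ = η} ≤ LinearMap.range P := by
      rw [Submodule.span_le]
      rintro _ ⟨a, ha, ξ, rfl⟩
      exact ⟨Finsupp.single ⟨a, ha⟩ ξ, hP _ _⟩
    have h2 : Dense (Submodule.span ℂ {η : H | ∃ a ∈ A, ∃ ξ : H, a ξ = η} : Set H) :=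
      Submodule.dense_iff_topologicalClosure_eq_top.2 hnd
    exact h2.mono h1
  -- Because `M(e a) = M(e) a`, the operators `M(e)` approximate `T` on the range of `P`. Their
  -- norms are eventually at most `‖M‖`, which makes `T` well defined and bounded.
  have hQP : ∀ v, Tendsto (fun e : A => (M e : H →L[ℂ] H) (P v)) l (𝓝 (Q v)) := by
    intro v
    induction v using Finsupp.induction_linear with
    | zero => simp
    | add v w hv hw => simpa using hv.add hw
    | single a ξ =>
      have h1 := ((ContinuousLinearMap.apply ℂ H ξ).continuous.tendsto (M a : H →L[ℂ] H)).comp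
        ((continuous_subtype_val.tendsto _).comp ((M.continuous.tendsto a).comp (hla a)))
      rw [hP, hQ]
      refine h1.congr fun e => ?_
      simp only [Function.comp_apply, hM]
      rfl
  have hb : ∀ v, ‖Q v‖ ≤ ‖M‖ * ‖P v‖ := by
    intro v
    refine le_of_tendsto (hQP v).norm ?_
    filter_upwards [hl] with e he
    refine ((M e : H →L[ℂ] H).le_opNorm _).trans ?_
    gcongr
    exact (M.le_opNorm e).trans (mul_le_of_le_one_right (norm_nonneg _) he)
  have hT : ∀ a : A, (M a : H →L[ℂ] H) = Q.extendOfNorm P * (a : H →L[ℂ] H) := fun a => by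
    ext ξ
    rw [mul_apply_eq_comp, ← hP a, LinearMap.extendOfNorm_eq hd ⟨_, hb⟩, hQ]
  exact ⟨Q.extendOfNorm P, fun a ha => by rw [← hT ⟨a, ha⟩]; exact (M ⟨a, ha⟩).2, hT⟩

/-- A sequence `c` in `M(A)` for which `∑ cₙ cₙ*` converges strictly has bounded sums. -/
theorem IsMultSeq.hasBoundedSums (hnd : ActsNondegenerately A) {c : ℕ → H →L[ℂ] H}
    (hc : IsMultSeq A c) : HasBoundedSums c := by
  obtain ⟨s, -, hs⟩ := hc.2
  let S : ℕ → H →L[ℂ] H := fun N => ∑ n ∈ Finset.range N, c n * star (c n)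
  -- Strict convergence bounds the maps `a ↦ S_N a` pointwise on the Banach space `A`; uniform
  -- boundedness then bounds their norms, which control `‖S_N‖` by non-degeneracy.
  let g : ℕ → A →L[ℂ] (H →L[ℂ] H) := fun N =>
    (ContinuousLinearMap.mul ℂ (H →L[ℂ] H) (S N)).comp
      (⟨A.toNonUnitalSubalgebra.toSubmodule.subtype, continuous_subtype_val⟩ : A →L[ℂ] (H →L[ℂ] H))
  obtain ⟨C, hC⟩ := banach_steinhaus (g := g) fun a => by
    obtain ⟨C, hC⟩ := (hs a a.2).2.norm.bddAbove_range
    exact ⟨C, fun N => hC ⟨N, rfl⟩⟩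
  refine ⟨C, fun N => hnd.norm_le_of_mul ((norm_nonneg _).trans (hC 0)) fun a ha => ?_⟩
  exact ((g N).le_opNorm ⟨a, ha⟩).trans (mul_le_mul_of_nonneg_right (hC N) (norm_nonneg _))

end Nondegenerate

/-! ### Norm estimates and truncations of sequences -/

section StrongSeq

variable {H : Type*} [NormedAddCommGroup H] [InnerProductSpace ℂ H] [CompleteSpace H]

namespace StrongSeq

theorem norm_sq (x : StrongSeq H) : ‖x‖ ^ 2 = ‖ip x x‖ := by
  rw [norm_def, Real.sq_sqrt (norm_nonneg _)]

/-- The norm is that of the column operator, and the norm of a Hilbert sum is monotone in the norms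
of the entries. -/
theorem norm_le_of_star_apply_le {x y : StrongSeq H}
    (h : ∀ n ξ, ‖star (x n) ξ‖ ≤ ‖star (y n) ξ‖) : ‖x‖ ≤ ‖y‖ := by
  rw [norm_eq_norm_col, norm_eq_norm_col]
  refine ContinuousLinearMap.opNorm_le_bound _ (norm_nonneg _) fun ξ => ?_
  refine le_trans ?_ (y.col.le_opNorm ξ)
  exact lp.norm_mono (E := fun _ : ℕ => H) (F := fun _ : ℕ => H) (p := 2) (by simp) fun n => h n ξ

theorem norm_apply_le (x : StrongSeq H) (n : ℕ) : ‖x n‖ ≤ ‖x‖ := by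
  rw [norm_eq_norm_col, ← norm_star]
  refine ContinuousLinearMap.opNorm_le_bound _ (norm_nonneg _) fun ξ => ?_
  refine le_trans ?_ (x.col.le_opNorm ξ)
  exact lp.norm_apply_le_norm (E := fun _ : ℕ => H) (p := 2) (by simp) (x.col ξ) n

theorem continuous_apply (n : ℕ) : Continuous fun x : StrongSeq H => x n :=
  AddMonoidHomClass.continuous_of_bound
    (⟨⟨fun x => x n, rfl⟩, fun _ _ => rfl⟩ : StrongSeq H →+ (H →L[ℂ] H)) 1
    fun x => by simpa using norm_apply_le x n

theorem norm_op_smul_le (b : H →L[ℂ] H) (x : StrongSeq H) : ‖b • x‖ ≤ ‖b‖ * ‖x‖ := by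
  have h : (b • x).col = x.col ∘L star b :=
    ContinuousLinearMap.ext fun ξ => HilbertSum.ext fun n => by simp
  rw [norm_eq_norm_col, norm_eq_norm_col, h, mul_comm, ← norm_star b]
  exact ContinuousLinearMap.opNorm_comp_le _ _

theorem continuous_op_smul (b : H →L[ℂ] H) : Continuous fun x : StrongSeq H => b • x :=
  AddMonoidHomClass.continuous_of_bound
    (⟨⟨fun x => b • x, ext fun _ => mul_zero b⟩, fun _ _ => ext fun _ => mul_add b _ _⟩ :
      StrongSeq H →+ StrongSeq H) ‖b‖ (norm_op_smul_le b)

theorem ip_op_smul_right (b : H →L[ℂ] H) (x y : StrongSeq H) :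
    ip x (b • y) = ip x y * star b := by
  rw [← star_ip, ip_op_smul_left, star_mul, star_ip]

/-- The sequence that agrees with `f` on the finite set `s` and vanishes elsewhere. -/
noncomputable def ofFinset (s : Finset ℕ) (f : ℕ → H →L[ℂ] H) : StrongSeq H where
  toFun n := if n ∈ s then f n else 0
  hasBoundedSums := by
    refine ⟨∑ n ∈ s, ‖f n * star (f n)‖, fun N => ?_⟩
    have h : ∑ n ∈ Finset.range N, (if n ∈ s then f n else 0) * star (if n ∈ s then f n else 0) =
        ∑ n ∈ Finset.range N with n ∈ s, f n * star (f n) := by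
      rw [Finset.sum_filter]
      exact Finset.sum_congr rfl fun n _ => by split_ifs <;> simp
    rw [h]
    exact (norm_sum_le _ _).trans (Finset.sum_le_sum_of_subset_of_nonneg
      (fun n hn => (Finset.mem_filter.1 hn).2) fun _ _ _ => norm_nonneg _)

theorem ofFinset_apply (s : Finset ℕ) (f : ℕ → H →L[ℂ] H) (n : ℕ) :
    ofFinset s f n = if n ∈ s then f n else 0 := rfl

theorem ofFinset_mem {S : Type*} [SetLike S (H →L[ℂ] H)] [ZeroMemClass S (H →L[ℂ] H)] {B : S}
    {s : Finset ℕ} {f : ℕ → H →L[ℂ] H} (hf : ∀ n ∈ s, f n ∈ B) (n : ℕ) : ofFinset s f n ∈ B := by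
  rw [ofFinset_apply]
  split_ifs with h
  exacts [hf n h, zero_mem B]

theorem ip_ofFinset (s : Finset ℕ) (f : ℕ → H →L[ℂ] H) (y : StrongSeq H) :
    ip (ofFinset s f) y = ∑ n ∈ s, f n * star (y n) := by
  ext ξ
  refine (hasSum_ip _ _ ξ).unique ?_
  have h := hasSum_sum_of_ne_finset_zero (s := s) (L := SummationFilter.unconditional ℕ)
    (f := fun n => (ofFinset s f n * star (y n)) ξ) (fun n hn => by simp [ofFinset_apply, hn])
  convert h using 1
  rw [sum_apply]
  exact Finset.sum_congr rfl fun n hn => by simp [ofFinset_apply, hn]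

theorem ip_ofFinset_right (s : Finset ℕ) (x : StrongSeq H) (f : ℕ → H →L[ℂ] H) :
    ip x (ofFinset s f) = ∑ n ∈ s, x n * star (f n) := by
  rw [← star_ip, ip_ofFinset, star_sum]
  exact Finset.sum_congr rfl fun n _ => by simp

theorem norm_ofFinset_sq (s : Finset ℕ) (f : ℕ → H →L[ℂ] H) :
    ‖ofFinset s f‖ ^ 2 = ‖∑ n ∈ s, f n * star (f n)‖ := by
  rw [norm_sq, ip_ofFinset]
  congr 1
  exact Finset.sum_congr rfl fun n hn => by simp [ofFinset_apply, hn]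

theorem norm_ofFinset_mul_le (s : Finset ℕ) (x : StrongSeq H) {b : H →L[ℂ] H} (hb : ‖b‖ ≤ 1) :
    ‖ofFinset s fun n => x n * b‖ ≤ ‖x‖ := by
  refine norm_le_of_star_apply_le fun n ξ => ?_
  rw [ofFinset_apply]
  split_ifs
  · rw [star_mul]
    refine ((star b).le_opNorm _).trans (mul_le_of_le_one_left (norm_nonneg _) ?_)
    rwa [norm_star]
  · simp

theorem norm_ofFinset_le (s : Finset ℕ) (x : StrongSeq H) : ‖ofFinset s x‖ ≤ ‖x‖ := by
  refine norm_le_of_star_apply_le fun n ξ => ?_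
  rw [ofFinset_apply]
  split_ifs <;> simp

/-- The difference vanishes on `s` and agrees with `x` off `s`, so its inner square is the tail of
the series of `ip x x`. -/
theorem norm_sub_ofFinset_sq (s : Finset ℕ) (x : StrongSeq H) :
    ‖x - ofFinset s x‖ ^ 2 = ‖ip x x - ∑ n ∈ s, x n * star (x n)‖ := by
  have h : ip (x - ofFinset s x) (x - ofFinset s x) =
      ip x x - ip (ofFinset s x) (ofFinset s x) := by
    ext ξ
    refine (hasSum_ip _ _ ξ).unique ?_
    refine ((hasSum_ip x x ξ).sub (hasSum_ip (ofFinset s x) (ofFinset s x) ξ)).congr_fun ?_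
    intro n
    change ((x n - ofFinset s x n) * star (x n - ofFinset s x n)) ξ = _
    rw [ofFinset_apply]
    split_ifs <;> simp
  rw [norm_sq, h, ip_ofFinset]
  congr 2
  exact Finset.sum_congr rfl fun n hn => by simp [ofFinset_apply, hn]

theorem tendsto_ofFinset_iff (x : StrongSeq H) :
    Tendsto (fun N => ofFinset (Finset.range N) x) atTop (𝓝 x) ↔
      Tendsto (fun N => ∑ n ∈ Finset.range N, x n * star (x n)) atTop (𝓝 (ip x x)) := by
  rw [tendsto_iff_norm_sub_tendsto_zero,
    tendsto_iff_norm_sub_tendsto_zero (b := ip x x)]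
  simp only [norm_sub_rev _ x, norm_sub_rev _ (ip x x), ← norm_sub_ofFinset_sq]
  constructor
  · intro h
    simpa using h.pow 2
  · intro h
    simpa using h.sqrt

end StrongSeq

end StrongSeq

/-! ### Closedness of `ℓ²(A)` and the description of `M(ℓ²(A))` -/

section Closed

variable {H : Type*} [NormedAddCommGroup H] [InnerProductSpace ℂ H] [CompleteSpace H]
variable {A : NonUnitalStarSubalgebra ℂ (H →L[ℂ] H)}

open StrongSeq

variable [hA : IsClosed (A : Set (H →L[ℂ] H))]

/-- Norm convergence of `∑ xₙ xₙ*` becomes approximation by truncations, a form that passes to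
limits and shows that finite sequences are dense. -/
theorem mem_ellTwo_iff {x : StrongSeq H} : x ∈ ellTwo A ↔
    (∀ n, x n ∈ A) ∧ Tendsto (fun N => ofFinset (Finset.range N) x) atTop (𝓝 x) := by
  rw [tendsto_ofFinset_iff]
  constructor
  · exact fun h => ⟨h.1, IsEllTwo.tendsto_ip h x⟩
  · exact fun h => ⟨h.1, _, hA.mem_of_tendsto h.2 (Eventually.of_forall fun _ =>
      sum_mem fun n _ => mul_mem (h.1 n) (star_mem (h.1 n))), h.2⟩

theorem ofFinset_mem_ellTwo {s : Finset ℕ} {f : ℕ → H →L[ℂ] H} (hf : ∀ n ∈ s, f n ∈ A) :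
    ofFinset s f ∈ ellTwo A := by
  refine mem_ellTwo_iff.2 ⟨ofFinset_mem hf, ?_⟩
  obtain ⟨N, hN⟩ := s.exists_nat_subset_range
  refine tendsto_const_nhds.congr' ?_
  filter_upwards [eventually_ge_atTop N] with k hk
  ext1 n
  rw [ofFinset_apply (Finset.range k)]
  split_ifs with h
  · rfl
  · rw [ofFinset_apply, if_neg fun hn => h (Finset.range_mono hk (hN hn))]

theorem isClosed_ellTwo : IsClosed (ellTwo A : Set (StrongSeq H)) := by
  refine isClosed_of_closure_subset fun x hx => mem_ellTwo_iff.2 ⟨fun n => ?_, ?_⟩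
  · have h := map_mem_closure (continuous_apply n) hx (t := (A : Set (H →L[ℂ] H)))
      fun y hy => (mem_ellTwo_iff.1 hy).1 n
    rwa [hA.closure_eq] at h
  · rw [Metric.tendsto_atTop]
    intro ε hε
    obtain ⟨y, hy, hd⟩ := Metric.mem_closure_iff.1 hx (ε / 3) (by positivity)
    obtain ⟨N, hN⟩ := Metric.tendsto_atTop.1 (mem_ellTwo_iff.1 hy).2 (ε / 3) (by positivity)
    refine ⟨N, fun n hn => ?_⟩
    -- Truncation is linear and contractive, so the approximation of `y` by its truncations carries
    -- over to `x`.
    have h1 : dist (ofFinset (Finset.range n) x) (ofFinset (Finset.range n) y) ≤ dist x y := by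
      rw [dist_eq_norm, dist_eq_norm]
      refine le_of_eq_of_le (congrArg norm ?_) (norm_ofFinset_le (Finset.range n) (x - y))
      ext1 k
      change ofFinset _ x k - ofFinset _ y k = _
      simp only [ofFinset_apply]
      split_ifs
      · rfl
      · simp
    have := dist_triangle4 (ofFinset (Finset.range n) x) (ofFinset (Finset.range n) y) y x
    have := hN n hn
    rw [dist_comm x y] at *
    linarith

/-- Multiplying by `a` and `a*` on the two sides turns strict convergence of `∑ xₙ xₙ*` into norm
convergence. -/
theorem op_smul_mem_ellTwo {x : StrongSeq H} (hx : x ∈ multModule A) {a : H →L[ℂ] H} (ha : a ∈ A) :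
    a • x ∈ ellTwo A := by
  refine mem_ellTwo_iff.2 ⟨fun n => (hx.1 n a ha).2, ?_⟩
  rw [tendsto_ofFinset_iff]
  have h := (IsMultSeq.tendsto_ip hx x ha).mul_const (star a)
  rw [ip_op_smul_left, ip_op_smul_right, ← mul_assoc]
  refine h.congr fun N => ?_
  rw [Finset.mul_sum, Finset.sum_mul]
  exact Finset.sum_congr rfl fun n _ => by simp [mul_assoc]

/-- `M(ℓ²(A))` consists of the sequences `t` in `ℓ²_strong(LM(A))` with `A t ⊆ ℓ²(A)`. -/
theorem mem_multModule_iff {t : StrongSeq H} :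
    t ∈ multModule A ↔ t ∈ strongLM A ∧ ∀ a ∈ A, a • t ∈ ellTwo A := by
  refine ⟨fun h => ⟨multModule_le_strongLM A h, fun a ha => op_smul_mem_ellTwo h ha⟩, fun h => ?_⟩
  have hm : ∀ n, t n ∈ multipliers A := fun n a ha => ⟨h.1 n a ha, (h.2 a ha).1 n⟩
  -- Pairing `a t` in `ℓ²(A)` with the merely bounded sequence `t` already gives norm convergence of
  -- `∑ a tₙ tₙ*`; adjoints give the other half of strict convergence.
  have hl : ∀ a ∈ A, Tendsto (fun N => a * ∑ n ∈ Finset.range N, t n * star (t n)) atTop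
      (𝓝 (a * t.ip t)) := fun a ha => by
    have h1 := IsEllTwo.tendsto_ip (h.2 a ha) t
    rw [ip_op_smul_left] at h1
    refine h1.congr fun N => ?_
    rw [Finset.mul_sum]
    exact Finset.sum_congr rfl fun n _ => by simp [mul_assoc]
  have hr : ∀ a ∈ A, Tendsto (fun N => (∑ n ∈ Finset.range N, t n * star (t n)) * a) atTop
      (𝓝 (t.ip t * a)) := fun a ha => by
    have h1 := (hl _ (star_mem ha)).star
    rw [star_mul, star_ip, star_star] at h1
    refine h1.congr fun N => ?_
    rw [star_mul, star_star, star_sum]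
    congr 1
    exact Finset.sum_congr rfl fun n _ => by simp
  have h0 : ∀ N, ∑ n ∈ Finset.range N, t n * star (t n) ∈ multipliers A := fun N =>
    sum_mem fun n _ => mul_mem (hm n) (star_mem (hm n))
  refine ⟨hm, t.ip t, fun a ha => ⟨?_, ?_⟩, fun a ha => ⟨hl a ha, hr a ha⟩⟩
  · exact hA.mem_of_tendsto (hr a ha) (Eventually.of_forall fun N => (h0 N a ha).1)
  · exact hA.mem_of_tendsto (hl a ha) (Eventually.of_forall fun N => (h0 N a ha).2)

theorem completeSpace_multModule [CompleteSpace (strongLM A)] : CompleteSpace (multModule A) := by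
  have h : (multModule A : Set (StrongSeq H)) =
      (strongLM A : Set (StrongSeq H)) ∩ ⋂ a ∈ A, (fun t => a • t) ⁻¹' (ellTwo A) := by
    ext t
    simp [mem_multModule_iff]
  have h1 : IsComplete (strongLM A : Set (StrongSeq H)) := completeSpace_coe_iff_isComplete.1 ‹_›
  have h2 : IsClosed (multModule A : Set (StrongSeq H)) := by
    rw [h]
    exact h1.isClosed.inter (isClosed_biInter fun a _ =>
      isClosed_ellTwo.preimage (continuous_op_smul a))
  refine completeSpace_coe_iff_isComplete.2 fun f hf hfs => ?_
  -- Completeness is available only for `strongLM A`, so the limit is taken there and closedness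
  -- puts it into `multModule A`.
  obtain ⟨x, -, hx⟩ := h1 f hf (hfs.trans (principal_mono.2 (multModule_le_strongLM A)))
  exact ⟨x, isClosed_iff_forall_filter.1 h2 x f hf.1 hfs hx, hx⟩

end Closed

/-! ### Completeness of the dual and rules for its elements -/

instance {A X : Type*} [NonUnitalCStarAlgebra A] [NormedAddCommGroup X] [NormedSpace ℂ X]
    [SMul A X] : CompleteSpace (ModuleDual A X) := by
  have h : IsClosed (moduleDual A X : Set (X →L[ℂ] A)) := by
    -- Each condition `L (a x) = a L(x)` is closed, since evaluation at a point is continuous in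
    -- `L`.
    have h1 : (moduleDual A X : Set (X →L[ℂ] A)) =
        ⋂ (a : A) (x : X), {L : X →L[ℂ] A | L (a • x) = a * L x} := by
      ext L
      simp [moduleDual]
    rw [h1]
    exact isClosed_iInter fun a => isClosed_iInter fun x =>
      isClosed_eq (ContinuousLinearMap.apply ℂ A (a • x)).continuous
        (continuous_const.mul (ContinuousLinearMap.apply ℂ A x).continuous)
  exact h.completeSpace_coe

theorem ModuleDual.le_opNorm {A X : Type*} [NonUnitalCStarAlgebra A] [NormedAddCommGroup X]
    [NormedSpace ℂ X] [SMul A X] (L : ModuleDual A X) (x : X) : ‖L x‖ ≤ ‖L‖ * ‖x‖ :=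
  (show moduleDual A X from L).1.le_opNorm x

theorem ModuleDual.continuous {A X : Type*} [NonUnitalCStarAlgebra A] [NormedAddCommGroup X]
    [NormedSpace ℂ X] [SMul A X] (L : ModuleDual A X) : Continuous L :=
  (show moduleDual A X from L).1.continuous

theorem ModuleDual.map_add {A X : Type*} [NonUnitalCStarAlgebra A] [NormedAddCommGroup X]
    [NormedSpace ℂ X] [SMul A X] (L : ModuleDual A X) (x y : X) : L (x + y) = L x + L y :=
  _root_.map_add (show moduleDual A X from L).1 x y

theorem ModuleDual.map_smul {A X : Type*} [NonUnitalCStarAlgebra A] [NormedAddCommGroup X]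
    [NormedSpace ℂ X] [SMul A X] (L : ModuleDual A X) (z : ℂ) (x : X) : L (z • x) = z • L x :=
  _root_.map_smul (show moduleDual A X from L).1 z x

theorem ModuleDual.map_sum {A X ι : Type*} [NonUnitalCStarAlgebra A] [NormedAddCommGroup X]
    [NormedSpace ℂ X] [SMul A X] (L : ModuleDual A X) (s : Finset ι) (f : ι → X) :
    L (∑ i ∈ s, f i) = ∑ i ∈ s, L (f i) :=
  _root_.map_sum (show moduleDual A X from L).1 f s

/-! ### The duality maps -/

section Duality

variable {H : Type*} [NormedAddCommGroup H] [InnerProductSpace ℂ H] [CompleteSpace H]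
variable {A : NonUnitalStarSubalgebra ℂ (H →L[ℂ] H)}

open StrongSeq

/-- `ℓ²_strong(LM(A))` is normed by `ℓ²(A)`. -/
theorem ActsNondegenerately.norm_le_of_ip [hA : IsClosed (A : Set (H →L[ℂ] H))]
    (hnd : ActsNondegenerately A) {t : StrongSeq H}
    (ht : t ∈ strongLM A) {K : ℝ} (hK : 0 ≤ K) (h : ∀ x ∈ ellTwo A, ‖ip x t‖ ≤ K * ‖x‖) :
    ‖t‖ ≤ K := by
  obtain ⟨l, _, hl, -, hξ⟩ := hnd.exists_approximateUnit
  have h1 : ∀ (N : ℕ) (ξ : H),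
      ‖∑ n ∈ Finset.range N, (t n * star (t n)) ξ‖ ≤ K * ‖t‖ * ‖ξ‖ := by
    intro N ξ
    have h2 : Tendsto (fun e : A => ∑ n ∈ Finset.range N, (t n * e * star (t n)) ξ) l
        (𝓝 (∑ n ∈ Finset.range N, (t n * star (t n)) ξ)) :=
      tendsto_finsetSum _ fun n _ => ((t n).continuous.tendsto _).comp (hξ (star (t n) ξ))
    refine le_of_tendsto h2.norm ?_
    filter_upwards [hl] with e he
    -- The test sequence `(tₙ e)` for `n < N` lies in `ℓ²(A)` and has norm at most `‖t‖`.
    have h3 := h (ofFinset (Finset.range N) fun n => t n * e)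
      (ofFinset_mem_ellTwo fun n _ => ht n e e.2)
    rw [ip_ofFinset] at h3
    rw [← sum_apply]
    refine (ContinuousLinearMap.le_opNorm _ ξ).trans ?_
    gcongr
    exact h3.trans (mul_le_mul_of_nonneg_left (norm_ofFinset_mul_le _ t he) hK)
  have h4 : ‖ip t t‖ ≤ K * ‖t‖ := ContinuousLinearMap.opNorm_le_bound _
    (mul_nonneg hK (norm_nonneg t)) fun ξ =>
      le_of_tendsto (hasSum_ip t t ξ).tendsto_sum_nat.norm (Eventually.of_forall fun N => h1 N ξ)
  -- Now `‖t‖ ‖t‖ ≤ K ‖t‖`, and `‖t‖` cancels unless it is zero.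
  rw [← norm_sq, sq] at h4
  rcases (norm_nonneg t).eq_or_lt with h5 | h5
  · rwa [← h5]
  · exact le_of_mul_le_mul_right h4 h5

theorem mul_star_mem {t : H →L[ℂ] H} (ht : t ∈ leftMultipliers A) {a : H →L[ℂ] H} (ha : a ∈ A) :
    a * star t ∈ A := by
  simpa using star_mem (ht _ (star_mem ha))

variable [hA : IsClosed (A : Set (H →L[ℂ] H))]

/-- The series converges in norm because `x` lies in `ℓ²(A)`, its terms `xₙ tₙ* = (tₙ xₙ*)*` lie in
`A`, and `A` is closed. -/
theorem ip_mem_of_strongLM {x t : StrongSeq H} (hx : x ∈ ellTwo A) (ht : t ∈ strongLM A) :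
    ip x t ∈ A :=
  hA.mem_of_tendsto (IsEllTwo.tendsto_ip hx t) (Eventually.of_forall fun _ =>
    sum_mem fun n _ => mul_star_mem (ht n) (hx.1 n))

/-- The linear map `x ↦ ∑ xₙ tₙ*` on `ℓ²(A)`. -/
noncomputable def ipLinearMap (t : strongLM A) : ellTwo A →ₗ[ℂ] A where
  toFun x := ⟨ip x.1 t.1, ip_mem_of_strongLM x.2 t.2⟩
  map_add' x y := Subtype.ext (ip_add_left x.1 y.1 t.1)
  map_smul' z x := Subtype.ext (ip_smul_left z x.1 t.1)

theorem norm_ipLinearMap_le (t : strongLM A) (x : ellTwo A) :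
    ‖ipLinearMap t x‖ ≤ ‖t‖ * ‖x‖ := by
  rw [mul_comm]
  exact norm_ip_le x.1 t.1

/-- The functional `x ↦ ∑ xₙ tₙ*` on `ℓ²(A)`. -/
noncomputable def dualOf (t : strongLM A) : Dual A :=
  (⟨(ipLinearMap t).mkContinuous ‖t‖ (norm_ipLinearMap_le t),
    fun a x => Subtype.ext <| by
      change ip ((a : H →L[ℂ] H) • x.1) t.1 = (a : H →L[ℂ] H) * ip x.1 t.1
      exact ip_op_smul_left _ _ _⟩ : moduleDual A (ellTwo A))

theorem dualOf_apply (t : strongLM A) (x : ellTwo A) :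
    (dualOf t x : H →L[ℂ] H) = ip x.1 t.1 := rfl

theorem dualOf_add (s t : strongLM A) : dualOf (s + t) = dualOf s + dualOf t := by
  refine DFunLike.ext _ _ fun x => Subtype.ext ?_
  change ip x.1 (s.1 + t.1) = ip x.1 s.1 + ip x.1 t.1
  exact ip_add_right _ _ _

theorem dualOf_smul (z : ℂ) (t : strongLM A) : dualOf (z • t) = star z • dualOf t := by
  refine DFunLike.ext _ _ fun x => Subtype.ext ?_
  change ip x.1 (z • t.1) = star z • ip x.1 t.1
  exact ip_smul_right _ _ _

theorem norm_dualOf_le (t : strongLM A) : ‖dualOf t‖ ≤ ‖t‖ :=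
  LinearMap.mkContinuous_norm_le _ (norm_nonneg t) (norm_ipLinearMap_le t)

theorem ActsNondegenerately.norm_dualOf (hnd : ActsNondegenerately A) (t : strongLM A) :
    ‖dualOf t‖ = ‖t‖ :=
  (norm_dualOf_le t).antisymm <| hnd.norm_le_of_ip t.2 (norm_nonneg _) fun x hx =>
    ModuleDual.le_opNorm (dualOf t) ⟨x, hx⟩

/-- The sequence in `ℓ²(A)` with the single entry `a` in place `n`. -/
noncomputable def ellTwoSingle (n : ℕ) (a : A) : ellTwo A :=
  ⟨ofFinset {n} fun _ => a, ofFinset_mem_ellTwo fun _ _ => a.2⟩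

theorem ellTwoSingle_apply (n : ℕ) (a : A) (k : ℕ) :
    (ellTwoSingle n a).1 k = if k = n then (a : H →L[ℂ] H) else 0 := by
  simp [ellTwoSingle, ofFinset_apply]

theorem ellTwo_ext {x y : ellTwo A} (h : ∀ n, x.1 n = y.1 n) : x = y :=
  Subtype.ext (StrongSeq.ext h)

theorem norm_ellTwoSingle (n : ℕ) (a : A) : ‖ellTwoSingle n a‖ = ‖a‖ := by
  have h := norm_ofFinset_sq {n} fun _ => (a : H →L[ℂ] H)
  rw [Finset.sum_singleton, CStarRing.norm_self_mul_star, ← sq] at h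
  exact (sq_eq_sq₀ (norm_nonneg _) (norm_nonneg _)).1 h

theorem ofFinset_eq_sum (x : ellTwo A) (s : Finset ℕ) :
    ofFinset s x.1 = (∑ n ∈ s, ellTwoSingle n ⟨x.1 n, x.2.1 n⟩ : ellTwo A).1 := by
  induction s using Finset.induction_on with
  | empty => ext1 n; simp [ofFinset_apply]
  | insert m s hm ih =>
    rw [Finset.sum_insert hm, Submodule.coe_add, ← ih]
    ext1 n
    rw [StrongSeq.add_apply, ellTwoSingle_apply, ofFinset_apply, ofFinset_apply]
    by_cases h : n = m
    · subst h; simp [hm]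
    · simp [h]

/-- The values of a functional on the sequences with a single entry in place `n` are given by a left
multiplier. -/
theorem ActsNondegenerately.exists_coefficient (hnd : ActsNondegenerately A) (L : Dual A) (n : ℕ) :
    ∃ T ∈ leftMultipliers A, ∀ a : A,
      (L (ellTwoSingle n a) : H →L[ℂ] H) = a * star T := by
  -- `L` is left `A`-linear, while left multipliers represent right `A`-linear maps; taking adjoints
  -- of argument and value converts one into the other.
  let M : A →L[ℂ] A := LinearMap.mkContinuous
    { toFun := fun a => star (L (ellTwoSingle n (star a)))
      map_add' := fun a b => by
        rw [← star_add, ← ModuleDual.map_add]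
        congr 2
        refine ellTwo_ext fun k => ?_
        change _ = (ellTwoSingle n (star a)).1 k + (ellTwoSingle n (star b)).1 k
        simp only [ellTwoSingle_apply]
        split_ifs <;> simp
      map_smul' := fun z a => by
        have h : ellTwoSingle n (star (z • a)) = star z • ellTwoSingle n (star a) := by
          refine ellTwo_ext fun k => ?_
          change _ = star z • (ellTwoSingle n (star a)).1 k
          simp only [ellTwoSingle_apply]
          split_ifs <;> simp
        rw [h, ModuleDual.map_smul, star_smul, star_star, RingHom.id_apply] } ‖L‖ fun a => by
      have h : ∀ b : A, ‖star b‖ = ‖b‖ := fun b => norm_star (b : H →L[ℂ] H)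
      refine (h _).trans_le ((ModuleDual.le_opNorm L _).trans_eq ?_)
      rw [norm_ellTwoSingle, h]
  have hM : ∀ a, M a = star (L (ellTwoSingle n (star a))) := fun _ => rfl
  obtain ⟨T, hT, h⟩ := hnd.exists_leftMultiplier M fun a b => by
    have h : ellTwoSingle n (star (a * b)) = star b • ellTwoSingle n (star a) := by
      refine ellTwo_ext fun k => ?_
      change _ = ((star b : A) : H →L[ℂ] H) * (ellTwoSingle n (star a)).1 k
      simp only [ellTwoSingle_apply]
      split_ifs <;> simp
    rw [hM, hM, h, ModuleDual.map_op_smul, star_mul, star_star]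
  refine ⟨T, hT, fun a => ?_⟩
  have h1 := h (star a)
  rw [hM, star_star] at h1
  have h2 := congrArg star h1
  simpa using h2

theorem ActsNondegenerately.dualOf_surjective (hnd : ActsNondegenerately A) :
    Function.Surjective (dualOf : strongLM A → Dual A) := by
  intro L
  choose T hT hL using hnd.exists_coefficient L
  have hf : ∀ (s : Finset ℕ) (x : ellTwo A),
      (L ⟨ofFinset s x.1, ofFinset_mem_ellTwo fun n _ => x.2.1 n⟩ : H →L[ℂ] H) =
        ∑ n ∈ s, x.1 n * star (T n) := fun s x => by
    have h : (⟨ofFinset s x.1, ofFinset_mem_ellTwo fun n _ => x.2.1 n⟩ : ellTwo A) =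
        ∑ n ∈ s, ellTwoSingle n ⟨x.1 n, x.2.1 n⟩ := Subtype.ext (ofFinset_eq_sum x s)
    rw [h, ModuleDual.map_sum, AddSubmonoidClass.coe_finsetSum]
    exact Finset.sum_congr rfl fun n _ => hL n _
  have hb : HasBoundedSums T := by
    refine ⟨‖L‖ ^ 2, fun N => ?_⟩
    rw [← norm_ofFinset_sq]
    refine pow_le_pow_left₀ (norm_nonneg _) ?_ 2
    -- The functional of the truncated `T` is `x ↦ L(truncation of x)`, whose norm is at most `‖L‖`.
    refine hnd.norm_le_of_ip (fun n => ofFinset_mem (fun n _ => hT n) n) (norm_nonneg L)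
      fun x hx => ?_
    rw [ip_ofFinset_right, ← hf _ ⟨x, hx⟩]
    refine (ModuleDual.le_opNorm L _).trans ?_
    gcongr
    exact norm_ofFinset_le _ x
  refine ⟨⟨⟨T, hb⟩, hT⟩, DFunLike.ext _ _ fun x => Subtype.ext ?_⟩
  rw [dualOf_apply]
  -- `L` and the functional of `T` agree on truncations, and the truncations of `x` converge to `x`.
  have h1 : Tendsto (fun N => (⟨ofFinset (Finset.range N) x.1,
      ofFinset_mem_ellTwo fun n _ => x.2.1 n⟩ : ellTwo A)) atTop (𝓝 x) :=
    tendsto_subtype_rng.2 (mem_ellTwo_iff.1 x.2).2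
  have h2 := (continuous_subtype_val.tendsto _).comp ((ModuleDual.continuous L).tendsto x |>.comp h1)
  refine tendsto_nhds_unique (IsEllTwo.tendsto_ip x.2 _) (h2.congr fun N => ?_)
  exact hf _ x

/-- The anti-linear isometric isomorphism `t ↦ (x ↦ ∑ xₙ tₙ*)` of `ℓ²_strong(LM(A))` onto
`ℓ²(A)′`. -/
noncomputable def strongLMEquivDual (hnd : ActsNondegenerately A) : strongLM A ≃ₗᵢ⋆[ℂ] Dual A :=
  LinearIsometryEquiv.ofSurjective
    { toFun := dualOf
      map_add' := dualOf_add
      map_smul' := dualOf_smul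
      norm_map' := hnd.norm_dualOf } hnd.dualOf_surjective

theorem isAdjoint_op_smul (hnd : ActsNondegenerately A) (s : multModule A) :
    IsAdjoint (strongLMEquivDual hnd (Submodule.inclusion (multModule_le_strongLM A) s))
      fun b => ⟨(b : H →L[ℂ] H) • s.1, op_smul_mem_ellTwo s.2 b.2⟩ :=
  fun x b => Subtype.ext <| by
    change ip x.1 s.1 * star (b : H →L[ℂ] H) = ip x.1 ((b : H →L[ℂ] H) • s.1)
    exact (ip_op_smul_right _ _ _).symm

/-- If the functional given by `t` is adjointable, then `t` belongs to `M(ℓ²(A))`. -/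
theorem mem_multModule_of_isAdjoint (hnd : ActsNondegenerately A) {t : strongLM A}
    {R : A → ellTwo A} (hR : IsAdjoint (strongLMEquivDual hnd t) R) : t.1 ∈ multModule A := by
  refine mem_multModule_iff.2 ⟨t.2, fun b hb => ?_⟩
  -- The sequences `b t` and `R b` define the same functional `x ↦ L_t(x) b*`, so injectivity
  -- identifies them.
  have h : (⟨b, hb⟩ : A) • t = Submodule.inclusion
      ((ellTwo_le_multModule A).trans (multModule_le_strongLM A)) (R ⟨b, hb⟩) := by
    refine (strongLMEquivDual hnd).injective (DFunLike.ext _ _ fun x => Subtype.ext ?_)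
    change ip x.1 (b • t.1) = ip x.1 (R ⟨b, hb⟩).1
    rw [ip_op_smul_right]
    exact congrArg Subtype.val (hR x ⟨b, hb⟩)
  have h1 : b • t.1 = (R ⟨b, hb⟩).1 := congrArg Subtype.val h
  rw [h1]
  exact (R ⟨b, hb⟩).2

/-- The anti-linear isometric isomorphism of `M(ℓ²(A))` onto `ℓ²(A)*`. -/
noncomputable def multModuleEquivAdjointableDual (hnd : ActsNondegenerately A) :
    multModule A ≃ₗᵢ⋆[ℂ] adjointableDual A :=
  LinearIsometryEquiv.ofSurjective
    { toFun := fun s => ⟨strongLMEquivDual hnd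
        (Submodule.inclusion (multModule_le_strongLM A) s), _, isAdjoint_op_smul hnd s⟩
      map_add' := fun s t => Subtype.ext ((strongLMEquivDual hnd).map_add
        (Submodule.inclusion (multModule_le_strongLM A) s)
        (Submodule.inclusion (multModule_le_strongLM A) t))
      map_smul' := fun z t => Subtype.ext ((strongLMEquivDual hnd).map_smulₛₗ z
        (Submodule.inclusion (multModule_le_strongLM A) t))
      norm_map' := fun s => (strongLMEquivDual hnd).norm_map
        (Submodule.inclusion (multModule_le_strongLM A) s) } <| by
    rintro ⟨L, R, hR⟩
    obtain ⟨t, rfl⟩ := (strongLMEquivDual hnd).surjective L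
    exact ⟨⟨t.1, mem_multModule_of_isAdjoint hnd hR⟩, rfl⟩

end Duality

end StandardModule

open StandardModule Filter Topology in
theorem theorem2p3 {H : Type*} [NormedAddCommGroup H] [InnerProductSpace ℂ H] [CompleteSpace H]
    (A : NonUnitalStarSubalgebra ℂ (H →L[ℂ] H)) [hA : IsClosed (A : Set (H →L[ℂ] H))]
    (hnd : ActsNondegenerately A) :
    -- `M(ℓ²(A))`, defined by strict convergence alone, consists of sequences with bounded sums
    (∀ c : ℕ → H →L[ℂ] H, IsMultSeq A c → HasBoundedSums c) ∧
    -- `ℓ²_strong(LM(A))` and `M(ℓ²(A))` are complete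
    CompleteSpace (strongLM A) ∧ CompleteSpace (multModule A) ∧
    ∃ (φ : strongLM A ≃ₗᵢ⋆[ℂ] Dual A) (ψ : multModule A ≃ₗᵢ⋆[ℂ] adjointableDual A),
      -- `φ(t)` maps `x` to the norm convergent sum `∑ xₙ tₙ*`
      (∀ (t : strongLM A) (x : ellTwo A),
        Tendsto (fun N => ∑ n ∈ Finset.range N, x.1 n * star (t.1 n)) atTop
          (𝓝 (φ t x : H →L[ℂ] H))) ∧
      -- `φ` is compatible with the actions of `A`
      (∀ (b : A) (t : strongLM A), φ (b • t) = dualMul (φ t) (star (toMultiplier A b))) ∧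
      -- `ψ` is the restriction of `φ` to `M(ℓ²(A))`
      (∀ s : multModule A,
        (ψ s).1 = φ (Submodule.inclusion (multModule_le_strongLM A) s)) ∧
      -- `ψ` is compatible with the actions of `M(A)` and with the inner products in `M(A)`
      (∀ (m : multipliers A) (s : multModule A),
        (ψ (m • s)).1 = dualMul (ψ s).1 (star m)) ∧
      (∀ s t : multModule A, IsDualInner (ψ s) (ψ t) (multInner s t)) ∧
      -- on `ℓ²(A)` the map is the canonical embedding `x ↦ ⟨·, x⟩`
      (∀ x y : ellTwo A,
        (ψ (Submodule.inclusion (ellTwo_le_multModule A) x)).1 y = ellTwoInner y x) := by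
  -- Completeness is transported from the dual along the isometry.
  have hc : CompleteSpace (strongLM A) :=
    (strongLMEquivDual hnd).toIsometryEquiv.completeSpace
  refine ⟨fun c hc => hc.hasBoundedSums hnd, hc, completeSpace_multModule,
    strongLMEquivDual hnd, multModuleEquivAdjointableDual hnd, fun t x => ?_, fun b t => ?_,
    fun s => rfl, fun m s => ?_, fun s t => ?_, fun x y => rfl⟩
  · exact IsEllTwo.tendsto_ip x.2 t.1
  · refine DFunLike.ext _ _ fun x => Subtype.ext ?_
    change x.1.ip ((b : H →L[ℂ] H) • t.1) = x.1.ip t.1 * star (b : H →L[ℂ] H)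
    exact StrongSeq.ip_op_smul_right _ _ _
  · refine DFunLike.ext _ _ fun x => Subtype.ext ?_
    change x.1.ip ((m : H →L[ℂ] H) • s.1) = x.1.ip s.1 * star (m : H →L[ℂ] H)
    exact StrongSeq.ip_op_smul_right _ _ _
  · refine ⟨_, isAdjoint_op_smul hnd s, fun a => ?_⟩
    change StrongSeq.ip ((a : H →L[ℂ] H) • s.1) t.1 = (a : H →L[ℂ] H) * s.1.ip t.1
    exact StrongSeq.ip_op_smul_left _ _ _
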